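/- Let $\mathsf G$ be a finite connected graph with vertex set $\mathsf V$ (loops and multiple edges allowed), with a fixed orientation, and let $\mathsf E^+$ be the set of positively oriented edges; $e\in\mathsf E^+$ starts at $\underline e$ and ends at $\overline e$. Let $\mathbb K=\mathbb R$ or $\mathbb C$. Let $\Omega_1=\mathbb K^{\mathsf E^+}$ be the space of $1$-chains, $\partial e=\overline e-\underline e$ the boundary operator and $Z_1=\ker\partial\subseteq\Omega_1$ the space of cycles. Let $\Omega^1=\mathbb K^{\mathsf E^+}$ be the space of $1$-forms, with canonical basis $(e^\star)$ dual to $\mathsf E^+$, let $\Omega^0=\mathbb K^{\mathsf V}$ have its standard inner product, and let $d:\Omega^0\to\Omega^1$, $(df)_e=f(\overline e)-f(\underline e)$. Fix weights $x_e>0$, $e\in \mathsf E^+$, endow $\Omega^1$ with the inner product $\langle\alpha,\beta\rangle=\sum_{e} x_e\overline{\alpha_e}\beta_e$, let $d^*$ be the adjoint of $d$, and let $\mathsf J_x:\Omega_1\to\Omega^1$ be the antilinear isomorphism with $\mathsf J_x e=x_e^{-1}e^\star$. Write $\omega_e=e^\star/\sqrt{x_e}$ and $x^F=\prod_{e\in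 F}x_e$. For a spanning forest $F\subseteq\mathsf E^+$, let $B^1(\mathsf G_{/F},\mathbb Z)\subseteq\mathbb Z^{\mathsf E^+}$ be the group of integral cuts of the contracted graph, that is, the group of all $(f(\overline e)-f(\underline e))_{e}$ where $f:\mathsf V\to\mathbb Z$ is constant on every connected component of $F$. Let $\mathcal F_{k+1}(\mathsf G)$ be the set of spanning forests with exactly $k+1$ connected components. For $F\in\mathcal F_{k+1}(\mathsf G)$ the group $B^1(\mathsf G_{/F},\mathbb Z)$ has an integral basis with $k$ elements; let $b_F\in\bigwedge^k\Omega^1$ be the exterior product of the elements of such a basis (it is defined up to sign). **Theorem.** Let $k\ge1$ and let $\Phi\subseteq\Omega_1$ be a $k$-dimensional linear subspace with $\Phi\cap Z_1=\{0\}$. Let $\varphi\in\bigwedge^k\Omega_1$ be the exterior product of the elements of a basis of $\Phi$. Then the measure on $\mathcal F_{k+1}(\mathsf G)$ which gives to $F$ the weight $$w(F)=x^F\,|(\varphi,b_F)|^2,$$ where $(\cdot,\cdot)$ is the duality pairing of $\bigwedge^k\Omega_1$ and $\bigwedge^k\Omega^1$, is not zero. The sum $\ker d^*\oplus\mathsf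 J_x\Phi$ is direct, and $$H:=(\ker d^*\oplus\mathsf J_x\Phi)^\perp=\operatorname{im}d\cap(\mathsf J_x\Phi)^\perp .$$ The probability measure $\mathbb P$ proportional to $w$ is determinantal, with kernel the matrix in the orthonormal basis $(\omega_e)$ of the orthogonal projection $\Pi^H$ on $H$: for every $J\subseteq\mathsf E^+$, $$\mathbb P(J\subseteq F)=\det\big(\langle\omega_e,\Pi^H\omega_{e'}\rangle\big)_{e,e'\in J}.$$ -/

import Mathlib

open scoped InnerProductSpace
open Module

/-- A graph with a fixed orientation; loops and multiple edges are allowed. The type `E` is the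
set of positively oriented edges, so it has one element for each geometric edge; `src e` and
`tgt e` are the starting and the ending vertex of `e`. A spanning subgraph is given by its set
`F : Finset E` of edges. -/
structure OrientedGraph (V E : Type*) where
  src : E → V
  tgt : E → V

namespace OrientedGraph

variable {V E : Type*} (G : OrientedGraph V E)

/-- `u` is the starting vertex and `v` the ending vertex of an edge in `F`. -/
def Arrow (F : Finset E) (u v : V) : Prop := ∃ e ∈ F, G.src e = u ∧ G.tgt e = v

/-- `u` and `v` are joined by a path of edges in `F`, each used in either direction. -/
def Joined (F : Finset E) (u v : V) : Prop := Relation.EqvGen (G.Arrow F) u v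

/-- The relation of being joined in the spanning subgraph `F`. -/
def componentSetoid (F : Finset E) : Setoid V := Relation.EqvGen.setoid (G.Arrow F)

/-- The set of connected components of the spanning subgraph `F`. -/
def Components (F : Finset E) : Type _ := Quotient (G.componentSetoid F)

/-- The whole graph is connected. -/
def Connected [Fintype E] : Prop := Nonempty V ∧ ∀ u v : V, G.Joined Finset.univ u v

/-- `F` contains no cycle: no edge of `F` has its end points joined by the other edges of `F`
(a loop is a cycle, and so is a pair of parallel edges). -/
def Acyclic [DecidableEq E] (F : Finset E) : Prop :=
  ∀ e ∈ F, ¬ G.Joined (F.erase e) (G.src e) (G.tgt e)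

open Classical in
/-- The spanning forests with exactly `m` connected components, as a finite set of edge sets. -/
noncomputable def spanningForests [Fintype E] (m : ℕ) : Finset (Finset E) :=
  Finset.univ.filter fun F => G.Acyclic F ∧ Nat.card (G.Components F) = m

/-- The boundary operator from `1`-chains to `0`-chains, `e ↦ tgt e - src e`. -/
noncomputable def boundary (R : Type*) [CommRing R] [Fintype E] [DecidableEq V] :
    (E → R) →ₗ[R] (V → R) :=
  Fintype.linearCombination R fun e => Pi.single (G.tgt e) 1 - Pi.single (G.src e) 1

/-- The group `Z₁(G, R)` of cycles. -/
noncomputable def cycles (R : Type*) [CommRing R] [Fintype E] [DecidableEq V] :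
    Submodule R (E → R) :=
  LinearMap.ker (G.boundary R)

/-- The coboundary operator from `0`-cochains to `1`-cochains. -/
def coboundary (R : Type*) [CommRing R] : (V → R) →ₗ[R] (E → R) where
  toFun f e := f (G.tgt e) - f (G.src e)
  map_add' f g := by ext e; simp only [Pi.add_apply]; ring
  map_smul' c f := by ext e; simp only [Pi.smul_apply, smul_eq_mul, RingHom.id_apply]; ring

/-- The `0`-cochains `C⁰(G/F, ℤ)` of the contracted graph: the integer functions on the vertices
that are constant on each connected component of `F`. -/
def contractedCochains (F : Finset E) : Submodule ℤ (V → ℤ) where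
  carrier := {f | ∀ u v, G.Joined F u v → f u = f v}
  add_mem' hf hg u v h := by simp only [Pi.add_apply, hf u v h, hg u v h]
  zero_mem' _ _ _ := rfl
  smul_mem' c f hf u v h := by simp only [Pi.smul_apply, hf u v h]

/-- The integral cuts `B¹(G/F, ℤ)` of the contracted graph, inside `C¹(G, ℤ)`. -/
def contractedCuts (F : Finset E) : Submodule ℤ (E → ℤ) :=
  (G.contractedCochains F).map (G.coboundary ℤ)

end OrientedGraph

/-- The pairing of the `k`-th exterior power of `1`-cochains with the `k`-th exterior power of
`1`-chains induced by the pairing `(α, a) = ∑ e, α e * a e`. -/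
noncomputable def wedgePairing {𝕜 E : Type*} [Field 𝕜] [Fintype E] [DecidableEq E] {k : ℕ}
    (φ b : ⋀[𝕜]^k (E → 𝕜)) : 𝕜 :=
  exteriorPower.pairingDual 𝕜 (E → 𝕜) k
    (exteriorPower.map k (dotProductEquiv 𝕜 E).toLinearMap b) φ

/-- On decomposable elements the pairing is the determinant of the matrix of pairings. -/
theorem wedgePairing_ιMulti {𝕜 E : Type*} [Field 𝕜] [Fintype E] [DecidableEq E] {k : ℕ}
    (a α : Fin k → E → 𝕜) :
    wedgePairing (exteriorPower.ιMulti 𝕜 k a) (exteriorPower.ιMulti 𝕜 k α) =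
      (Matrix.of fun i j => ∑ e, α j e * a i e).det := by
  simp [wedgePairing, exteriorPower.map_apply_ιMulti, dotProduct]

/-- The exterior product `b` of an integral basis `κ` of a group `B` of integral `1`-cochains, in
the exterior power of the `𝕜`-valued `1`-cochains. -/
noncomputable def integralWedge (𝕜 : Type*) {E : Type*} [Field 𝕜] {k : ℕ}
    {B : Submodule ℤ (E → ℤ)} (κ : Basis (Fin k) ℤ B) : ⋀[𝕜]^k (E → 𝕜) :=
  exteriorPower.ιMulti 𝕜 k fun j e => (((κ j : E → ℤ) e : ℤ) : 𝕜)

/-- The weight `x^F |(φ, b)|²`. -/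
noncomputable def forestWeight {𝕜 E : Type*} [RCLike 𝕜] [Fintype E] [DecidableEq E] {k : ℕ}
    (x : E → {r : ℝ // 0 < r}) (φ b : ⋀[𝕜]^k (E → 𝕜)) (F : Finset E) : ℝ :=
  (∏ e ∈ F, (x e : ℝ)) * ‖wedgePairing φ b‖ ^ 2

/-- The space `Ω¹` of `1`-forms, as a type synonym that carries the inner product with the
positive edge weights `x`. -/
@[nolint unusedArguments]
def OneForm (𝕜 : Type*) {E : Type*} (_x : E → {r : ℝ // 0 < r}) : Type _ := E → 𝕜

namespace OneForm

variable {𝕜 E : Type*} [RCLike 𝕜] [Fintype E] (x : E → {r : ℝ // 0 < r})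

noncomputable instance : AddCommGroup (OneForm 𝕜 x) := inferInstanceAs (AddCommGroup (E → 𝕜))

noncomputable instance : Module 𝕜 (OneForm 𝕜 x) := inferInstanceAs (Module 𝕜 (E → 𝕜))

instance : FiniteDimensional 𝕜 (OneForm 𝕜 x) := inferInstanceAs (FiniteDimensional 𝕜 (E → 𝕜))

/-- The coefficients of a `1`-form in the basis of the `e*`. -/
def coeffs : OneForm 𝕜 x ≃ₗ[𝕜] (E → 𝕜) := LinearEquiv.refl 𝕜 (E → 𝕜)

/-- The weighted inner product `∑ e, x e * conj (α e) * β e`. -/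
@[reducible] noncomputable def innerCore : InnerProductSpace.Core 𝕜 (OneForm 𝕜 x) where
  inner α β := ∑ e, ((x e : ℝ) : 𝕜) * (starRingEnd 𝕜 (coeffs x α e) * coeffs x β e)
  conj_inner_symm α β := by
    simp only [map_sum, map_mul, RCLike.conj_ofReal, RCLike.conj_conj]
    exact Finset.sum_congr rfl fun e _ => by ring
  re_inner_nonneg α := by
    rw [map_sum]
    refine Finset.sum_nonneg fun e _ => ?_
    rw [RCLike.re_ofReal_mul, RCLike.conj_mul, ← RCLike.ofReal_pow, RCLike.ofReal_re]
    exact mul_nonneg (x e).2.le (sq_nonneg _)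
  add_left α β γ := by
    rw [← Finset.sum_add_distrib]
    refine Finset.sum_congr rfl fun e _ => ?_
    rw [map_add, Pi.add_apply, map_add]
    ring
  smul_left α β c := by
    rw [Finset.mul_sum]
    refine Finset.sum_congr rfl fun e _ => ?_
    rw [map_smul, Pi.smul_apply, smul_eq_mul, map_mul]
    ring
  definite α h := by
    have h' : ∑ e, (x e : ℝ) * ‖coeffs x α e‖ ^ 2 = 0 := by
      have h2 := congrArg RCLike.re h
      rw [map_sum, map_zero] at h2
      refine Eq.trans (Finset.sum_congr rfl fun e _ => ?_) h2
      rw [RCLike.re_ofReal_mul, RCLike.conj_mul, ← RCLike.ofReal_pow, RCLike.ofReal_re]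
    rw [Finset.sum_eq_zero_iff_of_nonneg
      fun e _ => mul_nonneg (x e).2.le (sq_nonneg _)] at h'
    apply (coeffs x).injective
    rw [map_zero]
    funext e
    have h3 := h' e (Finset.mem_univ e)
    simpa [(x e).2.ne'] using h3

noncomputable instance : NormedAddCommGroup (OneForm 𝕜 x) := (innerCore x).toNormedAddCommGroup

noncomputable instance : InnerProductSpace 𝕜 (OneForm 𝕜 x) :=
  InnerProductSpace.ofCore (innerCore x).toCore

theorem inner_eq (α β : OneForm 𝕜 x) :
    ⟪α, β⟫_𝕜 = ∑ e, ((x e : ℝ) : 𝕜) * (starRingEnd 𝕜 (coeffs x α e) * coeffs x β e) := rfl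

/-- The antilinear isomorphism `J_x` from `1`-chains to `1`-forms, `e ↦ (x e)⁻¹ e*`. -/
noncomputable def J : (E → 𝕜) →ₛₗ[starRingEnd 𝕜] OneForm 𝕜 x where
  toFun a := (coeffs x).symm fun e => ((x e : ℝ) : 𝕜)⁻¹ * starRingEnd 𝕜 (a e)
  map_add' a b := by
    rw [← map_add]
    congr 1
    funext e
    rw [Pi.add_apply, Pi.add_apply, map_add, mul_add]
  map_smul' c a := by
    rw [← map_smul]
    congr 1
    funext e
    rw [Pi.smul_apply, Pi.smul_apply, smul_eq_mul, smul_eq_mul, map_mul]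
    ring

/-- `J_x` represents the pairing with a chain by the weighted inner product. -/
theorem inner_J (a : E → 𝕜) (α : OneForm 𝕜 x) : ⟪J x a, α⟫_𝕜 = ∑ e, coeffs x α e * a e := by
  rw [inner_eq]
  refine Finset.sum_congr rfl fun e _ => ?_
  have hx : ((x e : ℝ) : 𝕜) ≠ 0 := by exact_mod_cast (x e).2.ne'
  change _ * (starRingEnd 𝕜 (((x e : ℝ) : 𝕜)⁻¹ * starRingEnd 𝕜 (a e)) * _) = _
  rw [map_mul, map_inv₀, RCLike.conj_ofReal, RCLike.conj_conj]
  field_simp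

/-- The normalized basis vector `ω_e = e* / √(x e)`. -/
noncomputable def omega [DecidableEq E] (e : E) : OneForm 𝕜 x :=
  (coeffs x).symm (Pi.single e ((Real.sqrt (x e) : ℝ) : 𝕜)⁻¹)

/-- The matrix, in the orthonormal basis `ω`, of the orthogonal projection on `H`. -/
noncomputable def projectionKernel [DecidableEq E] (H : Submodule 𝕜 (OneForm 𝕜 x)) :
    Matrix E E 𝕜 :=
  Matrix.of fun e e' => ⟪(omega x e : OneForm 𝕜 x), H.starProjection (omega x e')⟫_𝕜

end OneForm

/-- The differential `d` from `0`-forms, with their standard inner product, to `1`-forms. -/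
noncomputable def OrientedGraph.differential {V E : Type*} (G : OrientedGraph V E)
    (𝕜 : Type*) [RCLike 𝕜] [Fintype V] [Fintype E] (x : E → {r : ℝ // 0 < r}) :
    EuclideanSpace 𝕜 V →ₗ[𝕜] OneForm 𝕜 x :=
  (OneForm.coeffs x).symm.toLinearMap ∘ₗ G.coboundary 𝕜 ∘ₗ
    (WithLp.linearEquiv 2 𝕜 (V → 𝕜)).toLinearMap

/-- The law on subsets of `E` that gives mass `p i` to the subset `X i` is determinantal with
kernel `K`: for every `J ⊆ E`, the probability that the random subset contains `J` is the
principal minor of `K` with rows and columns in `J`. -/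
def IsDeterminantal {ι 𝕜 E : Type*} [RCLike 𝕜] [Fintype ι] [DecidableEq E]
    (X : ι → Finset E) (p : ι → ℝ) (K : Matrix E E 𝕜) : Prop :=
  ∀ J : Finset E,
    ((∑ i with J ⊆ X i, p i : ℝ) : 𝕜) = (K.submatrix (fun e : J => (e : E)) fun e : J => (e : E)).det

/-! The subspace `H` has dimension `m = |V| - k - 1`, the number of edges of a spanning forest with
`k + 1` components. In the basis `ω` its projection is `K = A Aᴴ` with `Aᴴ A = 1`, and for such a
matrix the principal minors of size `m` over the sets containing `J` add up to the minor at `J`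
(`Matrix.sum_minors_eq_of_mul_eq_one`). It remains to show that, for `|F| = m`, the minor of `K` at
`F` is `c * w F` if `F` is a forest and `0` otherwise.

Let `C` collect the pairings of `df` with the basis of `Φ` and the value `f v₀`; then `d` maps `ker
C` isomorphically onto `H`. Completing the rows `F` of the matrix of `d` by `C` gives a square
matrix, whose squared determinant is the minor up to `x^F` and a factor independent of `F`
(`exists_projectionKernel_minor_eq`). It is singular if `F` has a cycle. For a forest, a unimodular
integral change of basis adapted to `F` reduces it to the pairing of `φ` with `b_F`, up to modulus
(`Acyclic.norm_det_coboundaryMatrix`). Taking `J = ∅` gives `c * ∑ w = 1`, hence both the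
normalization and the nonvanishing of `w`. -/

/-! ### Principal minors and Cauchy-Binet -/

/-- The determinant of `1 + M` is the sum of all principal minors of `M`. -/
theorem Matrix.det_one_add_eq_sum_minors {n R : Type*} [Fintype n] [DecidableEq n] [CommRing R]
    (M : Matrix n n R) :
    (1 + M).det = ∑ s : Finset n, (M.submatrix (Subtype.val : s → n) Subtype.val).det := by
  rw [add_comm]
  have h := (Matrix.detRowAlternating (n := n) (R := R)).map_add_univ M.row (1 : Matrix n n R).row
  refine Eq.trans h (Finset.sum_congr rfl fun s _ => ?_)
  exact Matrix.det_piecewise_one_eq_submatrix_det M s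

theorem Matrix.det_diagonal_mul_submatrix {n R : Type*} [Fintype n] [DecidableEq n] [CommRing R]
    (d : n → R) (M : Matrix n n R) (s : Finset n) :
    ((Matrix.diagonal d * M).submatrix (Subtype.val : s → n) Subtype.val).det =
      (∏ e ∈ s, d e) * (M.submatrix (Subtype.val : s → n) Subtype.val).det := by
  have : (Matrix.diagonal d * M).submatrix (Subtype.val : s → n) Subtype.val =
      Matrix.of fun i j : s => d i * M.submatrix (Subtype.val : s → n) Subtype.val i j := by
    ext i j
    simp [Matrix.diagonal_mul]
  rw [this, Matrix.det_mul_column, Finset.prod_coe_sort s d]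

open Polynomial in
/-- A form of the Cauchy-Binet formula, with principal minors. -/
theorem Matrix.det_mul_diagonal_mul {n R : Type*} [Fintype n] [DecidableEq n] [CommRing R] {m : ℕ}
    (A : Matrix n (Fin m) R) (B : Matrix (Fin m) n R) (d : n → R) :
    (B * Matrix.diagonal d * A).det = ∑ F ∈ Finset.univ.powersetCard m,
      (∏ e ∈ F, d e) * ((A * B).submatrix (Subtype.val : F → n) Subtype.val).det := by
  -- Both sides are the coefficient of `X ^ m` in `det (1 + X B d A) = det (1 + X d A B)`; an `m ×
  -- m` matrix has a single principal minor of size `m`.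
  have h1 := Matrix.coeff_det_one_add_X_smul_eq_sum_minors (B * Matrix.diagonal d * A) m
  have h2 := Matrix.coeff_det_one_add_X_smul_eq_sum_minors (Matrix.diagonal d * (A * B)) m
  simp_rw [Matrix.det_diagonal_mul_submatrix] at h2
  rw [← h2]
  have h3 : (Finset.univ : Finset (Fin m)).powersetCard m = {Finset.univ} := by
    have h := Finset.powersetCard_self (Finset.univ : Finset (Fin m))
    rwa [Finset.card_fin] at h
  rw [h3, Finset.sum_singleton] at h1
  have h4 : ∀ s : Finset (Fin m), s = Finset.univ → ∀ N : Matrix (Fin m) (Fin m) R,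
      (N.submatrix (Subtype.val : s → Fin m) Subtype.val).det = N.det := fun s hs N =>
    Matrix.det_submatrix_equiv_self (Equiv.subtypeUnivEquiv fun i => hs ▸ Finset.mem_univ i) N
  rw [h4 _ rfl] at h1
  rw [← h1]
  congr 1
  rw [Matrix.mul_assoc B, Matrix.map_mul, ← Matrix.mul_assoc,
    Matrix.map_mul (L := Matrix.diagonal d * A), ← Matrix.mul_smul, ← Matrix.smul_mul,
    Matrix.det_one_add_mul_comm]

/-- Uniqueness in Möbius inversion: by induction all terms but the one at `T` itself cancel. -/
theorem Finset.eq_of_sum_powerset_eq {α R : Type*} [DecidableEq α] [AddCommGroup R]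
    {f g : Finset α → R} (h : ∀ T : Finset α, ∑ S ∈ T.powerset, f S = ∑ S ∈ T.powerset, g S) : f = g := by
  funext T
  induction T using Finset.strongInduction with
  | H T ih =>
    have h1 := h T
    rw [← Finset.sum_erase_add _ _ (Finset.mem_powerset_self T),
      ← Finset.sum_erase_add _ _ (Finset.mem_powerset_self T),
      show ∑ S ∈ T.powerset.erase T, f S = ∑ S ∈ T.powerset.erase T, g S from
        Finset.sum_congr rfl fun S hS => ih S (Finset.mem_ssubsets.1 hS)] at h1
    exact add_left_cancel h1

/-- For the idempotent matrix `A * B` of rank `m`, where `B * A = 1`, the sum of the principal minors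
of size `m` that contain `J` is the principal minor indexed by `J`. -/
theorem Matrix.sum_minors_eq_of_mul_eq_one {n R : Type*} [Fintype n] [DecidableEq n]
    [CommRing R] {m : ℕ} (A : Matrix n (Fin m) R) (B : Matrix (Fin m) n R) (hA : B * A = 1)
    (J : Finset n) :
    ∑ F ∈ Finset.univ.powersetCard m with J ⊆ F,
      ((A * B).submatrix (Subtype.val : F → n) Subtype.val).det =
    ((A * B).submatrix (Subtype.val : J → n) Subtype.val).det := by
  set K := A * B with hK
  suffices h : (fun J : Finset n => ∑ F ∈ Finset.univ.powersetCard m with J ⊆ F,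
      (K.submatrix (Subtype.val : F → n) Subtype.val).det) =
      fun J : Finset n => (K.submatrix (Subtype.val : J → n) Subtype.val).det from congrFun h J
  -- After summation over `J ⊆ T`, both sides become `det (1 + d K)`, with `d` the indicator of `T`.
  -- Since `B A = 1`, this is also `det (B (1 + d) A)`, to which Cauchy-Binet applies.
  refine Finset.eq_of_sum_powerset_eq fun T => ?_
  set d : n → R := fun e => if e ∈ T then 1 else 0 with hd
  have hprod : ∀ S : Finset n, ∏ e ∈ S, d e = if S ⊆ T then 1 else 0 := fun S => by
    simp only [hd, Finset.prod_ite_zero, Finset.prod_const_one, Finset.subset_iff]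
  have h1 : (1 + Matrix.diagonal d * K).det = ∑ S ∈ T.powerset,
      (K.submatrix (Subtype.val : S → n) Subtype.val).det := by
    rw [Matrix.det_one_add_eq_sum_minors]
    simp_rw [Matrix.det_diagonal_mul_submatrix, hprod, ite_mul, one_mul, zero_mul]
    rw [← Finset.sum_filter]
    refine Finset.sum_congr ?_ fun _ _ => rfl
    ext S; simp
  have h2 : (1 + Matrix.diagonal d * K).det = (B * Matrix.diagonal (1 + d) * A).det := by
    rw [hK, ← Matrix.mul_assoc, Matrix.det_one_add_mul_comm, ← hA]
    congr 1
    have h : Matrix.diagonal (1 + d) = 1 + Matrix.diagonal d := by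
      rw [← Matrix.diagonal_one, Matrix.diagonal_add]; rfl
    rw [h, Matrix.mul_add, Matrix.add_mul, Matrix.mul_one, Matrix.mul_assoc]
  rw [← h1, h2, Matrix.det_mul_diagonal_mul]
  simp_rw [Finset.sum_filter]
  rw [Finset.sum_comm]
  refine Finset.sum_congr rfl fun F _ => ?_
  rw [← Finset.sum_filter, Finset.sum_const, nsmul_eq_mul]
  congr 1
  -- The weight `∏ e ∈ F, (1 + d e)` counts the sets `J ⊆ F ∩ T`.
  simp only [Pi.add_apply, Pi.one_apply]
  rw [Finset.prod_one_add]
  simp_rw [hprod]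
  rw [Finset.sum_boole]
  congr 2
  ext S; simp [and_comm]

/-! ### Forests, components and integral cuts -/

namespace OrientedGraph

variable {V E : Type*} (G : OrientedGraph V E)

theorem Joined.map_eq {G : OrientedGraph V E} {F : Finset E} {u v : V} (h : G.Joined F u v)
    {A : Type*} {f : V → A} (hf : ∀ e ∈ F, f (G.src e) = f (G.tgt e)) : f u = f v := by
  induction h with
  | rel u v h =>
    obtain ⟨e, he, rfl, rfl⟩ := h
    exact hf e he
  | refl u => rfl
  | symm u v _ ih => exact ih.symm
  | trans u v w _ _ ih₁ ih₂ => exact ih₁.trans ih₂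

theorem joined_of_mem {F : Finset E} {e : E} (he : e ∈ F) : G.Joined F (G.src e) (G.tgt e) :=
  Relation.EqvGen.rel _ _ ⟨e, he, rfl, rfl⟩

theorem mem_contractedCochains_iff {F : Finset E} {f : V → ℤ} :
    f ∈ G.contractedCochains F ↔ ∀ e ∈ F, G.coboundary ℤ f e = 0 := by
  constructor
  · intro hf e he
    exact sub_eq_zero.2 (hf _ _ (G.joined_of_mem he)).symm
  · intro hf u v huv
    exact huv.map_eq fun e he => (sub_eq_zero.1 (hf e he)).symm

/-- In a connected graph a cochain with zero coboundary is constant. -/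
theorem Connected.eq_of_coboundary_eq_zero {G : OrientedGraph V E} [Fintype E] (hG : G.Connected)
    {R : Type*} [CommRing R] {f : V → R} (hf : G.coboundary R f = 0) (u v : V) : f u = f v :=
  (hG.2 u v).map_eq fun e _ => (sub_eq_zero.1 (congrFun hf e)).symm

/-- The indicator function of the component of the forest `F` minus `e` that contains the end
of `e`. -/
theorem Acyclic.exists_coboundary_eq_single {G : OrientedGraph V E} [DecidableEq E] {F : Finset E}
    (hF : G.Acyclic F) (e : F) :
    ∃ f : V → ℤ, ∀ e' : F, G.coboundary ℤ f e' = if e' = e then 1 else 0 := by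
  classical
  refine ⟨fun v => if G.Joined (F.erase e) (G.tgt e) v then 1 else 0, fun e' => ?_⟩
  simp only [coboundary, LinearMap.coe_mk, AddHom.coe_mk]
  split_ifs with h₁ h₂ h₃ h₃ h₂ h₃ h₃ <;> try rfl
  · subst h₃
    exact absurd (Relation.EqvGen.symm _ _ h₂) (hF _ e'.2)
  · refine absurd (Relation.EqvGen.trans _ _ _ h₁ (Relation.EqvGen.symm _ _
      (G.joined_of_mem (Finset.mem_erase.2 ⟨fun h => h₃ (Subtype.ext h), e'.2⟩)))) h₂
  · subst h₃
    exact absurd (Relation.EqvGen.refl _) h₁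
  · refine absurd (Relation.EqvGen.trans _ _ _ h₂
      (G.joined_of_mem (Finset.mem_erase.2 ⟨fun h => h₃ (Subtype.ext h), e'.2⟩))) h₁
  · subst h₃
    exact absurd (Relation.EqvGen.refl _) h₁

/-- Cochains of the contracted graph are functions on the components. -/
def contractedCochainsEquiv (F : Finset E) :
    G.contractedCochains F ≃ₗ[ℤ] (G.Components F → ℤ) where
  toFun f := Quotient.lift f.1 f.2
  map_add' f g := by
    funext c
    induction c using Quotient.inductionOn
    rfl
  map_smul' a f := by
    funext c
    induction c using Quotient.inductionOn
    rfl
  invFun g := ⟨fun v => g (Quotient.mk _ v), fun u v h => congrArg g (Quotient.sound h)⟩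
  left_inv f := rfl
  right_inv g := by
    funext c
    induction c using Quotient.inductionOn
    rfl

theorem finrank_contractedCochains [Finite V] (F : Finset E) :
    finrank ℤ (G.contractedCochains F) = Nat.card (G.Components F) := by
  have : Finite (G.Components F) := inferInstanceAs (Finite (Quotient _))
  have := Fintype.ofFinite (G.Components F)
  rw [(G.contractedCochainsEquiv F).finrank_eq, Module.finrank_fintype_fun_eq_card,
    Nat.card_eq_fintype_card]

/-- The number of edges plus the number of components of a forest is the number of vertices. -/
theorem Acyclic.card_add_card_components {G : OrientedGraph V E} [Fintype V] [DecidableEq E]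
    {F : Finset E} (hF : G.Acyclic F) :
    F.card + Nat.card (G.Components F) = Fintype.card V := by
  -- Rank-nullity for `d` restricted to the edges of `F`: the kernel is the cochains of the
  -- contracted graph, and acyclicity makes the map surjective.
  set D : (V → ℤ) →ₗ[ℤ] (F → ℤ) := LinearMap.funLeft ℤ ℤ (fun e : F => (e : E)) ∘ₗ G.coboundary ℤ
    with hD
  have hker : LinearMap.ker D = G.contractedCochains F := by
    ext f
    rw [LinearMap.mem_ker, mem_contractedCochains_iff, funext_iff, Subtype.forall]
    rfl
  have hsurj : Function.Surjective D := by
    choose s hs using hF.exists_coboundary_eq_single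
    intro a
    refine ⟨∑ e, a e • s e, ?_⟩
    rw [map_sum]
    funext e'
    rw [Finset.sum_apply, Finset.sum_eq_single e']
    · rw [map_smul]
      change a e' * G.coboundary ℤ (s e') e' = _
      simp [hs]
    · intro e _ he
      rw [map_smul]
      change a e * G.coboundary ℤ (s e) e' = _
      simp [hs, he.symm]
    · simp
  have h := Submodule.finrank_quotient_add_finrank (LinearMap.ker D)
  rwa [(D.quotKerEquivOfSurjective hsurj).finrank_eq, hker, finrank_contractedCochains,
    Module.finrank_fintype_fun_eq_card, Module.finrank_fintype_fun_eq_card,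
    Fintype.card_coe] at h

/-- Rank-nullity for `d` on the contracted cochains: since the graph is connected, the kernel is the
constants, which account for the `+ 1`. -/
theorem Connected.finrank_contractedCuts_add_one {G : OrientedGraph V E} [Finite V] [Fintype E]
    (hG : G.Connected) (F : Finset E) :
    finrank ℤ (G.contractedCuts F) + 1 = Nat.card (G.Components F) := by
  obtain ⟨v₀⟩ := hG.1
  set T := (G.coboundary ℤ).domRestrict (G.contractedCochains F) with hT
  have hrange : LinearMap.range T = G.contractedCuts F := LinearMap.range_domRestrict _ _
  have h := Submodule.finrank_quotient_add_finrank (LinearMap.ker T)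
  set ev : LinearMap.ker T →ₗ[ℤ] ℤ := LinearMap.proj v₀ ∘ₗ
    (G.contractedCochains F).subtype ∘ₗ (LinearMap.ker T).subtype with hev
  have hbij : Function.Bijective ev := by
    constructor
    · intro f g hfg
      apply Subtype.ext
      apply Subtype.ext
      funext v
      have h1 := hG.eq_of_coboundary_eq_zero f.2 v v₀
      have h2 := hG.eq_of_coboundary_eq_zero g.2 v v₀
      exact h1.trans (Eq.trans hfg h2.symm)
    · intro a
      refine ⟨⟨⟨fun _ => a, fun _ _ _ => rfl⟩, ?_⟩, rfl⟩
      funext e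
      exact sub_self a
  rw [(LinearEquiv.ofBijective ev hbij).finrank_eq, T.quotKerEquivRange.finrank_eq, hrange,
    Module.finrank_self, finrank_contractedCochains] at h
  exact h

theorem Connected.nonempty_basis_contractedCuts {G : OrientedGraph V E} [Finite V] [Fintype E]
    (hG : G.Connected) {F : Finset E} {k : ℕ} (hF : Nat.card (G.Components F) = k + 1) :
    Nonempty (Basis (Fin k) ℤ (G.contractedCuts F)) := by
  have h := hG.finrank_contractedCuts_add_one F
  exact ⟨Module.finBasisOfFinrankEq ℤ _ (by omega)⟩

/-! ### Maximal minors of the completed coboundary matrix -/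

section Minors

variable [Fintype V] [DecidableEq V]

/-- The matrix of the coboundary operator. -/
def coboundaryMatrix (R : Type*) [CommRing R] : Matrix E V R :=
  LinearMap.toMatrix' (G.coboundary R)

theorem coboundaryMatrix_mulVec (R : Type*) [CommRing R] (f : V → R) :
    (G.coboundaryMatrix R).mulVec f = G.coboundary R f :=
  LinearMap.toMatrix'_mulVec _ _

theorem coboundaryMatrix_mul_apply (R : Type*) [CommRing R] {ι : Type*} (U : Matrix V ι R)
    (e : E) (i : ι) :
    (G.coboundaryMatrix R * U) e i = G.coboundary R (fun v => U v i) e := by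
  rw [← coboundaryMatrix_mulVec]
  rfl

/-- If `F` contains a cycle, a square matrix that contains the rows of the coboundary matrix
indexed by `F` is singular. -/
theorem det_coboundaryMatrix_eq_zero [DecidableEq E] {F : Finset E} (hF : ¬ G.Acyclic F)
    {R : Type*} [Field R] {m : ℕ} (r : Fin m ≃ F) {κ : Type*} [Fintype κ] [DecidableEq κ]
    (C : Matrix κ V R) (σ : Fin m ⊕ κ ≃ V) :
    (((G.coboundaryMatrix R).submatrix (fun i => (r i : E)) id).fromRows C |>.submatrix
      id σ).det = 0 := by
  simp only [Acyclic, not_forall, not_not] at hF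
  obtain ⟨e, he, hJ⟩ := hF
  -- Dropping the row of `e` leaves fewer equations than unknowns, hence a nonzero solution `f`. It
  -- is constant along the path joining the ends of `e`, so it also satisfies the dropped equation.
  set L : (V → R) →ₗ[R] (F.erase e → R) × (κ → R) :=
    (LinearMap.funLeft R R (fun e' : F.erase e => (e' : E)) ∘ₗ G.coboundary R).prod C.mulVecLin
    with hL
  have hcard : Fintype.card V = F.card + Fintype.card κ := by
    rw [← Fintype.card_congr σ, Fintype.card_sum, Fintype.card_congr r, Fintype.card_coe]
  have hlt : finrank R ((F.erase e → R) × (κ → R)) < finrank R (V → R) := by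
    have := Finset.card_pos.2 ⟨e, he⟩
    rw [Module.finrank_prod, Module.finrank_fintype_fun_eq_card,
      Module.finrank_fintype_fun_eq_card, Module.finrank_fintype_fun_eq_card, Fintype.card_coe,
      Finset.card_erase_of_mem he]
    omega
  obtain ⟨f, hf, hf0⟩ := Submodule.exists_mem_ne_zero_of_ne_bot
    (LinearMap.ker_ne_bot_of_finrank_lt hlt (f := L))
  obtain ⟨hf1, hf2⟩ := Prod.ext_iff.1 (LinearMap.mem_ker.1 hf)
  have hd : ∀ e' ∈ F.erase e, G.coboundary R f e' = 0 := fun e' h => congrFun hf1 ⟨e', h⟩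
  have hd' : ∀ e' ∈ F, G.coboundary R f e' = 0 := fun e' h => by
    by_cases h' : e' = e
    · subst h'
      exact sub_eq_zero.2 (hJ.map_eq fun e' h => (sub_eq_zero.1 (hd e' h)).symm).symm
    · exact hd e' (Finset.mem_erase.2 ⟨h', h⟩)
  refine Matrix.exists_mulVec_eq_zero_iff.1 ⟨f ∘ σ, fun h => hf0 ?_, ?_⟩
  · funext v
    simpa using congrFun h (σ.symm v)
  · rw [Matrix.submatrix_mulVec_equiv, Function.comp_assoc, Equiv.self_comp_symm,
      Function.comp_id, Function.comp_id, Matrix.fromRows_mulVec]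
    funext i
    rcases i with i | i
    · have := hd' _ (r i).2
      rw [← coboundaryMatrix_mulVec] at this
      exact this
    · exact congrFun hf2 i

/-- The rows of the coboundary matrix given by a spanning forest, completed by the evaluations at
the chains `a i` and by the evaluation at a vertex. -/
theorem Acyclic.norm_det_coboundaryMatrix {G : OrientedGraph V E} [Fintype E] [DecidableEq E]
    (hG : G.Connected) {F : Finset E} (hF : G.Acyclic F) {𝕜 : Type*} [RCLike 𝕜] {m k : ℕ}
    (r : Fin m ≃ F) (κ : Basis (Fin k) ℤ (G.contractedCuts F)) (a : Fin k → E → 𝕜) (v₀ : V)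
    (σ : Fin m ⊕ (Fin k ⊕ Unit) ≃ V) :
    ‖(((G.coboundaryMatrix 𝕜).submatrix (fun i => (r i : E)) id).fromRows
      ((Matrix.of a * G.coboundaryMatrix 𝕜).fromRows
        (Matrix.of fun (_ : Unit) => Pi.single v₀ 1)) |>.submatrix id σ).det‖ =
    ‖(Matrix.of fun i j => ∑ e, (((κ j : E → ℤ) e : ℤ) : 𝕜) * a i e).det‖ := by
  choose s hs using hF.exists_coboundary_eq_single
  have hf' : ∀ j, ∃ f ∈ G.contractedCochains F, G.coboundary ℤ f = (κ j : E → ℤ) := fun j => (κ j).2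
  choose f hf hfκ using hf'
  -- The columns form a basis of `ℤ^V`: potentials dual to the edges of `F`, primitives of the basis
  -- cuts, and the constant `1`.
  set P : Matrix V (Fin m ⊕ (Fin k ⊕ Unit)) ℤ :=
    (Matrix.of fun v i => s (r i) v).fromCols
      ((Matrix.of fun v j => f j v).fromCols (Matrix.of fun v _ => 1)) with hP
  have hunit : IsUnit (P.submatrix σ id).det := by
    rw [← Matrix.isUnit_iff_isUnit_det, ← Matrix.mulVec_surjective_iff_isUnit]
    -- To expand a function, subtract dual potentials until its coboundary vanishes on `F`, then
    -- primitives of cuts until its coboundary vanishes everywhere. What remains is constant.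
    intro g
    set g' : V → ℤ := g ∘ σ.symm with hg'
    set y : Fin m → ℤ := fun i => G.coboundary ℤ g' (r i) with hy
    set h : V → ℤ := g' - ∑ i, y i • s (r i) with hh
    have hhF : h ∈ G.contractedCochains F := by
      refine G.mem_contractedCochains_iff.2 fun e he => ?_
      obtain ⟨i, hi⟩ := r.surjective ⟨e, he⟩
      obtain rfl : (r i : E) = e := congrArg Subtype.val hi
      rw [hh, map_sub, map_sum, Pi.sub_apply, Finset.sum_apply, sub_eq_zero,
        Finset.sum_eq_single i]
      · rw [map_smul, Pi.smul_apply, hs, if_pos rfl, smul_eq_mul, mul_one]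
      · intro j _ hj
        rw [map_smul, Pi.smul_apply, hs, if_neg fun h => hj (r.injective h.symm), smul_zero]
      · simp
    set c := κ.repr ⟨G.coboundary ℤ h, Submodule.mem_map_of_mem hhF⟩ with hc
    set q : V → ℤ := h - ∑ j, c j • f j with hq
    have hdq : G.coboundary ℤ q = 0 := by
      have h1 := congrArg Subtype.val
        (κ.sum_repr ⟨G.coboundary ℤ h, Submodule.mem_map_of_mem hhF⟩)
      rw [hq, map_sub, map_sum, sub_eq_zero]
      refine h1.symm.trans ?_
      rw [AddSubmonoidClass.coe_finsetSum]
      exact Finset.sum_congr rfl fun j _ => by rw [map_smul, hfκ]; rfl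
    refine ⟨Sum.elim y (Sum.elim c fun _ => q v₀), ?_⟩
    have hPx : P.mulVec (Sum.elim y (Sum.elim c fun _ => q v₀)) = g' := by
      rw [hP, Matrix.fromCols_mulVec_sumElim, Matrix.fromCols_mulVec_sumElim]
      funext v
      have h1 : q v₀ = q v := hG.eq_of_coboundary_eq_zero hdq v₀ v
      have h2 : q v = g' v - ∑ i, s (r i) v * y i - ∑ j, f j v * c j := by
        simp only [hq, hh, Pi.sub_apply, Finset.sum_apply, Pi.smul_apply, smul_eq_mul, mul_comm]
      simp only [Pi.add_apply, Matrix.mulVec, dotProduct, Matrix.of_apply, Finset.univ_unique,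
        Finset.sum_const, Finset.card_singleton, one_smul, one_mul, h1, h2]
      ring
    funext i
    refine (congrFun hPx (σ i)).trans ?_
    simp [hg']
  have hnorm : ‖((P.map (Int.cast : ℤ → 𝕜)).submatrix σ id).det‖ = 1 := by
    have h1 : ((P.map (Int.cast : ℤ → 𝕜)).submatrix σ id).det =
        (((P.submatrix σ id).det : ℤ) : 𝕜) := by
      rw [Matrix.submatrix_map]
      exact ((Int.castRingHom 𝕜).map_det _).symm
    rw [h1]
    rcases Int.isUnit_iff.1 hunit with h | h <;> simp [h]
  -- Multiplication by the unimodular `P` makes the matrix block lower triangular, with diagonal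
  -- blocks `1`, the pairing matrix and `1`.
  rw [← mul_one ‖_‖, ← hnorm, ← norm_mul, ← Matrix.det_mul, Matrix.submatrix_mul_equiv,
    Matrix.submatrix_id_id, hP, Matrix.fromCols_map, Matrix.fromCols_map,
    Matrix.fromRows_mul_fromCols]
  have hcast : ∀ (g : V → ℤ) (e : E),
      G.coboundary 𝕜 (fun v => ((g v : ℤ) : 𝕜)) e = ((G.coboundary ℤ g e : ℤ) : 𝕜) :=
    fun g e => (Int.cast_sub _ _).symm
  have h1 : (G.coboundaryMatrix 𝕜).submatrix (fun i => (r i : E)) id *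
      (Matrix.of fun v i => s (r i) v).map (Int.cast : ℤ → 𝕜) = 1 := by
    ext i j
    refine (G.coboundaryMatrix_mul_apply 𝕜 _ _ _).trans ((hcast _ _).trans
      ((congrArg Int.cast (hs (r j) (r i))).trans ?_))
    rw [Matrix.one_apply]
    simp only [r.injective.eq_iff]
    split_ifs <;> simp
  have hconst : ∀ e, G.coboundary 𝕜 (fun _ : V => ((1 : ℤ) : 𝕜)) e = 0 := fun e => sub_self _
  have h2 : (G.coboundaryMatrix 𝕜).submatrix (fun i => (r i : E)) id *
      ((Matrix.of fun v j => f j v).map (Int.cast : ℤ → 𝕜)).fromCols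
        ((Matrix.of fun _ _ => 1 : Matrix V Unit ℤ).map (Int.cast : ℤ → 𝕜)) = 0 := by
    ext i j
    refine (G.coboundaryMatrix_mul_apply 𝕜 _ _ _).trans ?_
    rcases j with j | j
    · refine (hcast (f j) _).trans ?_
      rw [G.mem_contractedCochains_iff.1 (hf j) _ (r i).2, Int.cast_zero]
      rfl
    · exact hconst _
  have h3 : Matrix.of a * G.coboundaryMatrix 𝕜 *
      (Matrix.of fun _ _ => 1 : Matrix V Unit ℤ).map (Int.cast : ℤ → 𝕜) = 0 := by
    rw [Matrix.mul_assoc]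
    convert Matrix.mul_zero _
    ext e j
    exact (G.coboundaryMatrix_mul_apply 𝕜 _ _ _).trans (hconst e)
  have h4 : (Matrix.of fun (_ : Unit) => (Pi.single v₀ 1 : V → 𝕜)) *
      (Matrix.of fun _ _ => 1 : Matrix V Unit ℤ).map (Int.cast : ℤ → 𝕜) = 1 := by
    ext i j
    simp [Matrix.mul_apply]
  rw [h1, h2, Matrix.det_fromBlocks_zero₁₂, Matrix.det_one, one_mul,
    Matrix.fromRows_mul_fromCols, h3, h4, Matrix.det_fromBlocks_zero₁₂, Matrix.det_one, mul_one]
  congr 2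
  ext i j
  rw [Matrix.mul_assoc, Matrix.mul_apply]
  refine Finset.sum_congr rfl fun e _ => ?_
  rw [coboundaryMatrix_mul_apply, mul_comm]
  congr 1
  refine (hcast (f j) e).trans ?_
  rw [hfκ]

end Minors

end OrientedGraph

/-! ### The projection kernel in orthonormal coordinates -/

namespace OneForm

variable {𝕜 E : Type*} [RCLike 𝕜] [Fintype E] (x : E → {r : ℝ // 0 < r})

theorem inner_omega [DecidableEq E] (e : E) (β : OneForm 𝕜 x) :
    ⟪omega x e, β⟫_𝕜 = ((Real.sqrt (x e) : ℝ) : 𝕜) * coeffs x β e := by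
  rw [inner_eq, Finset.sum_eq_single e]
  · have hs : ((Real.sqrt (x e) : ℝ) : 𝕜) ≠ 0 := by
      exact_mod_cast (Real.sqrt_pos.2 (x e).2).ne'
    have hx : ((x e : ℝ) : 𝕜) = ((Real.sqrt (x e) : ℝ) : 𝕜) * ((Real.sqrt (x e) : ℝ) : 𝕜) := by
      rw [← RCLike.ofReal_mul, Real.mul_self_sqrt (x e).2.le]
    rw [omega, LinearEquiv.apply_symm_apply, Pi.single_eq_same, map_inv₀, RCLike.conj_ofReal, hx]
    field_simp
  · intro e' _ he'
    rw [omega, LinearEquiv.apply_symm_apply, Pi.single_eq_of_ne he']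
    simp
  · simp

theorem inner_eq_sum_inner_omega [DecidableEq E] (α β : OneForm 𝕜 x) :
    ⟪α, β⟫_𝕜 = ∑ e, starRingEnd 𝕜 ⟪omega x e, α⟫_𝕜 * ⟪omega x e, β⟫_𝕜 := by
  rw [inner_eq]
  refine Finset.sum_congr rfl fun e _ => ?_
  have hx : ((x e : ℝ) : 𝕜) = ((Real.sqrt (x e) : ℝ) : 𝕜) * ((Real.sqrt (x e) : ℝ) : 𝕜) := by
    rw [← RCLike.ofReal_mul, Real.mul_self_sqrt (x e).2.le]
  rw [inner_omega, inner_omega, map_mul, RCLike.conj_ofReal, hx]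
  ring

/-- The matrix of the coordinates of a family of `1`-forms in the orthonormal basis `ω`. -/
noncomputable def coordMatrix [DecidableEq E] {ι : Type*} (h : ι → OneForm 𝕜 x) : Matrix E ι 𝕜 :=
  Matrix.of fun e j => ⟪(omega x e : OneForm 𝕜 x), h j⟫_𝕜

theorem conjTranspose_coordMatrix_mul_self [DecidableEq E] {ι : Type*} [DecidableEq ι]
    {h : ι → OneForm 𝕜 x} (hh : Orthonormal 𝕜 h) :
    (coordMatrix x h).conjTranspose * coordMatrix x h = 1 := by
  ext i j
  rw [Matrix.mul_apply, Matrix.one_apply, ← orthonormal_iff_ite.1 hh i j,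
    inner_eq_sum_inner_omega]
  rfl

theorem projectionKernel_eq [DecidableEq E] {ι : Type*} [Fintype ι]
    {H : Submodule 𝕜 (OneForm 𝕜 x)} (h : OrthonormalBasis ι 𝕜 H) :
    projectionKernel x H = coordMatrix x (fun j => (h j : OneForm 𝕜 x)) *
      (coordMatrix x fun j => (h j : OneForm 𝕜 x)).conjTranspose := by
  ext e e'
  rw [Matrix.mul_apply, projectionKernel, Matrix.of_apply, h.starProjection_eq_sum_rankOne,
    sum_apply, inner_sum]
  refine Finset.sum_congr rfl fun j _ => ?_
  rw [InnerProductSpace.rankOne_apply, inner_smul_right, mul_comm, Matrix.conjTranspose_apply,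
    coordMatrix, Matrix.of_apply, Matrix.of_apply, RCLike.star_def, inner_conj_symm]

end OneForm

/-! ### The subspace `H` and its minors -/

namespace OrientedGraph

open OneForm

variable {𝕜 V E : Type*} [RCLike 𝕜] [DecidableEq V] [Fintype E] (G : OrientedGraph V E)

theorem boundary_apply (b : E → 𝕜) (v : V) :
    G.boundary 𝕜 b v = ∑ e, G.coboundary 𝕜 (Pi.single v 1) e * b e := by
  rw [boundary, Fintype.linearCombination_apply, Finset.sum_apply]
  refine Finset.sum_congr rfl fun e _ => ?_
  simp [coboundary, Pi.single_apply, mul_comm, eq_comm]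

theorem mem_cycles_of_forall {b : E → 𝕜}
    (hb : ∀ f : V → 𝕜, ∑ e, G.coboundary 𝕜 f e * b e = 0) : b ∈ G.cycles 𝕜 := by
  rw [cycles, LinearMap.mem_ker]
  funext v
  rw [boundary_apply, hb, Pi.zero_apply]

omit [DecidableEq V] in
theorem mem_spanningForests [DecidableEq E] {m : ℕ} {F : Finset E} :
    F ∈ G.spanningForests m ↔ G.Acyclic F ∧ Nat.card (G.Components F) = m := by
  classical
  rw [spanningForests]
  refine Finset.mem_filter.trans ((and_iff_right (Finset.mem_univ F)).trans ?_)
  congr!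

variable [Fintype V]

/-- If `d* (J x b) = 0`, then `b` pairs to zero with every `df`, so it is a cycle. -/
theorem disjoint_ker_adjoint_differential (x : E → {r : ℝ // 0 < r}) {Φ : Submodule 𝕜 (E → 𝕜)}
    (hΦ : Φ ⊓ G.cycles 𝕜 = ⊥) :
    Disjoint (LinearMap.ker (LinearMap.adjoint (G.differential 𝕜 x))) (Φ.map (J x)) := by
  rw [Submodule.disjoint_def]
  rintro _ hker ⟨b, hb, rfl⟩
  have hb0 : b ∈ Φ ⊓ G.cycles 𝕜 := by
    refine ⟨hb, G.mem_cycles_of_forall fun f => ?_⟩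
    have h := LinearMap.adjoint_inner_left (G.differential 𝕜 x) (WithLp.toLp 2 f) (J x b)
    rw [LinearMap.mem_ker.1 hker, inner_zero_left, inner_J] at h
    exact h.symm
  rw [hΦ, Submodule.mem_bot] at hb0
  rw [hb0, map_zero]

/-- The pairings with the chains `a i` of the coboundary of a `0`-cochain, and its value
at `v₀`. -/
noncomputable def evalMatrix {k : ℕ} (a : Fin k → E → 𝕜) (v₀ : V) :
    Matrix (Fin k ⊕ Unit) V 𝕜 :=
  (Matrix.of a * G.coboundaryMatrix 𝕜).fromRows (Matrix.of fun (_ : Unit) => Pi.single v₀ 1)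

theorem evalMatrix_mulVec_inl {k : ℕ} (a : Fin k → E → 𝕜) (v₀ : V) (f : V → 𝕜) (i : Fin k) :
    (G.evalMatrix a v₀).mulVec f (Sum.inl i) = ∑ e, G.coboundary 𝕜 f e * a i e := by
  rw [evalMatrix, Matrix.fromRows_mulVec, Sum.elim_inl, ← Matrix.mulVec_mulVec,
    coboundaryMatrix_mulVec]
  simp [Matrix.mulVec, dotProduct, mul_comm]

theorem evalMatrix_mulVec_inr {k : ℕ} (a : Fin k → E → 𝕜) (v₀ : V) (f : V → 𝕜) :
    (G.evalMatrix a v₀).mulVec f (Sum.inr ()) = f v₀ := by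
  rw [evalMatrix, Matrix.fromRows_mulVec, Sum.elim_inr]
  simp [Matrix.mulVec]

/-- The rows are independent: testing a relation on the function `1` removes the evaluation at `v₀`,
and what remains says that an element of `Φ` is a cycle. -/
theorem evalMatrix_mulVec_surjective {k : ℕ} {Φ : Submodule 𝕜 (E → 𝕜)}
    (hΦ : Φ ⊓ G.cycles 𝕜 = ⊥) (φ : Basis (Fin k) 𝕜 Φ) (v₀ : V) :
    Function.Surjective (G.evalMatrix (fun i => (φ i : E → 𝕜)) v₀).mulVec := by
  set C := G.evalMatrix (fun i => (φ i : E → 𝕜)) v₀ with hC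
  have hind : LinearIndependent 𝕜 C.row := by
    rw [← Matrix.vecMul_injective_iff, ← Matrix.coe_vecMulLinear, ← LinearMap.ker_eq_bot,
      LinearMap.ker_eq_bot']
    intro y hy
    have hpair : ∀ f : V → 𝕜, ∑ i, y (Sum.inl i) * ∑ e, G.coboundary 𝕜 f e * (φ i : E → 𝕜) e +
        y (Sum.inr ()) * f v₀ = 0 := fun f => by
      have h1 : (C.vecMul y) ⬝ᵥ f = 0 := by
        rw [← Matrix.vecMulLinear_apply, hy, zero_dotProduct]
      rw [← Matrix.dotProduct_mulVec, dotProduct, Fintype.sum_sum_type] at h1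
      simpa [hC, evalMatrix_mulVec_inl, evalMatrix_mulVec_inr] using h1
    have hy0 : y (Sum.inr ()) = 0 := by
      simpa [coboundary] using hpair fun _ => 1
    have hb : ∑ i, y (Sum.inl i) • (φ i : E → 𝕜) ∈ Φ ⊓ G.cycles 𝕜 := by
      refine ⟨Submodule.sum_mem _ fun i _ => Submodule.smul_mem _ _ (φ i).2,
        G.mem_cycles_of_forall fun f => ?_⟩
      have h1 := hpair f
      rw [hy0, zero_mul, add_zero] at h1
      rw [← h1]
      simp_rw [Finset.sum_apply, Finset.mul_sum]
      rw [Finset.sum_comm]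
      refine Finset.sum_congr rfl fun i _ => Finset.sum_congr rfl fun e _ => ?_
      rw [Pi.smul_apply, smul_eq_mul]
      ring
    rw [hΦ, Submodule.mem_bot] at hb
    have hb' : ∑ i, y (Sum.inl i) • φ i = 0 := by
      apply Subtype.ext
      rw [AddSubmonoidClass.coe_finsetSum]
      exact hb
    have h0 := Fintype.linearIndependent_iff.1 φ.linearIndependent _ hb'
    funext i
    rcases i with i | i
    · exact h0 i
    · exact hy0
  have hrank := hind.rank_matrix
  rw [Matrix.rank] at hrank
  have htop : LinearMap.range C.mulVecLin = ⊤ := by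
    apply Submodule.eq_top_of_finrank_eq
    rw [hrank, Module.finrank_fintype_fun_eq_card]
  exact LinearMap.range_eq_top.1 htop

/-- A primitive can be normalized to vanish at `v₀`, and by `inner_J` orthogonality to `J x b` is
vanishing of the pairing with `b`. -/
theorem range_differential_inf_orthogonal (x : E → {r : ℝ // 0 < r}) {k : ℕ}
    {Φ : Submodule 𝕜 (E → 𝕜)} (φ : Basis (Fin k) 𝕜 Φ) (v₀ : V) :
    LinearMap.range (G.differential 𝕜 x) ⊓ (Φ.map (J x))ᗮ =
      (LinearMap.ker (G.evalMatrix (fun i => (φ i : E → 𝕜)) v₀).mulVecLin).map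
        ((coeffs x).symm.toLinearMap ∘ₗ G.coboundary 𝕜) := by
  ext α
  constructor
  · rintro ⟨⟨f, rfl⟩, hα⟩
    have hd : G.coboundary 𝕜 (fun v => f v - f v₀) = G.coboundary 𝕜 f := by
      funext e
      exact sub_sub_sub_cancel_right _ _ _
    refine ⟨fun v => f v - f v₀, ?_, congrArg (coeffs x).symm hd⟩
    rw [SetLike.mem_coe, LinearMap.mem_ker, Matrix.mulVecLin_apply]
    funext i
    rcases i with i | i
    · rw [evalMatrix_mulVec_inl, hd]
      have h := (Submodule.mem_orthogonal _ _).1 hα _ (Submodule.mem_map_of_mem (φ i).2)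
      rw [inner_J] at h
      exact h
    · rw [evalMatrix_mulVec_inr]
      exact sub_self _
  · rintro ⟨f, hf, rfl⟩
    refine ⟨⟨WithLp.toLp 2 f, rfl⟩, ?_⟩
    rw [SetLike.mem_coe, Submodule.mem_orthogonal]
    rintro _ ⟨b, hb, rfl⟩
    rw [inner_J]
    change ∑ e, G.coboundary 𝕜 f e * b e = 0
    have hb' : b = ∑ i, φ.repr ⟨b, hb⟩ i • (φ i : E → 𝕜) := by
      have h := congrArg Subtype.val (φ.sum_repr ⟨b, hb⟩)
      rw [AddSubmonoidClass.coe_finsetSum] at h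
      exact h.symm
    rw [hb']
    simp_rw [Finset.sum_apply, Finset.mul_sum]
    rw [Finset.sum_comm]
    refine Finset.sum_eq_zero fun i _ => ?_
    have h := congrFun (LinearMap.mem_ker.1 hf) (Sum.inl i)
    rw [Matrix.mulVecLin_apply, evalMatrix_mulVec_inl, Pi.zero_apply] at h
    rw [← mul_zero (φ.repr ⟨b, hb⟩ i), ← h, Finset.mul_sum]
    refine Finset.sum_congr rfl fun e _ => ?_
    rw [Pi.smul_apply, smul_eq_mul]
    ring

/-- The evaluation matrix has rank `k + 1`, and `d` is injective on its kernel because a constant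
vanishing at `v₀` is zero. -/
theorem Connected.finrank_range_differential_inf_orthogonal {G : OrientedGraph V E}
    (hG : G.Connected) (x : E → {r : ℝ // 0 < r}) {k : ℕ} {Φ : Submodule 𝕜 (E → 𝕜)}
    (hΦ : Φ ⊓ G.cycles 𝕜 = ⊥) (φ : Basis (Fin k) 𝕜 Φ) :
    finrank 𝕜 (LinearMap.range (G.differential 𝕜 x) ⊓ (Φ.map (J x))ᗮ :
      Submodule 𝕜 (OneForm 𝕜 x)) + (k + 1) = Fintype.card V := by
  obtain ⟨v₀⟩ := hG.1
  rw [range_differential_inf_orthogonal G x φ v₀]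
  set L := (G.evalMatrix (fun i => (φ i : E → 𝕜)) v₀).mulVecLin with hL
  have hinj : Function.Injective (((coeffs x).symm.toLinearMap ∘ₗ G.coboundary 𝕜).domRestrict
      (LinearMap.ker L)) := by
    rw [← LinearMap.ker_eq_bot, LinearMap.ker_eq_bot']
    rintro ⟨f, hf⟩ hd
    have hd' : G.coboundary 𝕜 f = 0 := hd
    apply Subtype.ext
    funext v
    refine (hG.eq_of_coboundary_eq_zero hd' v v₀).trans ?_
    have h := congrFun (LinearMap.mem_ker.1 hf) (Sum.inr ())
    rwa [Matrix.mulVecLin_apply, evalMatrix_mulVec_inr] at h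
  have h := LinearMap.finrank_range_add_finrank_ker L
  have htop : LinearMap.range L = ⊤ :=
    LinearMap.range_eq_top.2 (G.evalMatrix_mulVec_surjective hΦ φ v₀)
  rw [htop, finrank_top, Module.finrank_fintype_fun_eq_card, Module.finrank_fintype_fun_eq_card,
    Fintype.card_sum, Fintype.card_fin, Fintype.card_unit] at h
  rw [← LinearMap.range_domRestrict, LinearMap.finrank_range_of_inj hinj]
  omega

/-- Up to a common factor, the principal minors of maximal rank of the projection kernel are weighted
squares of maximal minors of the coboundary matrix completed by the evaluation matrix. -/
theorem exists_projectionKernel_minor_eq [DecidableEq E] (x : E → {r : ℝ // 0 < r}) {k : ℕ} {Φ : Submodule 𝕜 (E → 𝕜)}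
    (hΦ : Φ ⊓ G.cycles 𝕜 = ⊥) (φ : Basis (Fin k) 𝕜 Φ) (v₀ : V) {m : ℕ}
    {H : Submodule 𝕜 (OneForm 𝕜 x)}
    (hH : H = LinearMap.range (G.differential 𝕜 x) ⊓ (Φ.map (J x))ᗮ)
    (h : OrthonormalBasis (Fin m) 𝕜 H) (σ : Fin m ⊕ (Fin k ⊕ Unit) ≃ V) :
    ∃ c : ℝ, ∀ (F : Finset E) (r : Fin m ≃ F),
      ((projectionKernel x H).submatrix (Subtype.val : F → E) Subtype.val).det =
        ((c * ((∏ e ∈ F, (x e : ℝ)) *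
          ‖(((G.coboundaryMatrix 𝕜).submatrix (fun i => (r i : E)) id).fromRows
            (G.evalMatrix (fun i => (φ i : E → 𝕜)) v₀) |>.submatrix id σ).det‖ ^ 2) : ℝ) : 𝕜) := by
  set C := G.evalMatrix (fun i => (φ i : E → 𝕜)) v₀ with hC
  obtain ⟨W, hW⟩ := Matrix.mulVec_surjective_iff_exists_right_inverse.1
    (G.evalMatrix_mulVec_surjective hΦ φ v₀)
  have hu : ∀ j, ∃ f : V → 𝕜, C.mulVec f = 0 ∧
      (coeffs x).symm (G.coboundary 𝕜 f) = (h j : OneForm 𝕜 x) := fun j => by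
    obtain ⟨f, hf, hfj⟩ := (hH.trans (G.range_differential_inf_orthogonal x φ v₀)).le (h j).2
    exact ⟨f, hf, hfj⟩
  choose u hu0 hud using hu
  set U : Matrix V (Fin m) 𝕜 := Matrix.of fun v j => u j v with hU
  have hCU : C * U = 0 := by
    ext i j
    exact congrFun (hu0 j) i
  -- `U` holds primitives of the orthonormal basis and `W` is a right inverse of `C`; neither
  -- depends on `F`.
  refine ⟨‖((U.fromCols W).submatrix σ id).det‖ ^ 2, fun F r => ?_⟩
  set D := (G.coboundaryMatrix 𝕜).submatrix (fun i => (r i : E)) id with hD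
  -- As `C U = 0` and `C W = 1`, the product of `(D; C)` with `(U | W)` is block upper triangular,
  -- with diagonal blocks `D U` and `1`.
  have hDU : (D * U).det = ((D.fromRows C).submatrix id σ).det *
      ((U.fromCols W).submatrix σ id).det := by
    rw [← Matrix.det_mul, Matrix.submatrix_mul_equiv, Matrix.submatrix_id_id,
      Matrix.fromRows_mul_fromCols, hCU, hW, Matrix.det_fromBlocks_zero₂₁, Matrix.det_one, mul_one]
  set A := (coordMatrix x fun j => (h j : OneForm 𝕜 x)).submatrix (fun i => (r i : E)) id with hA
  have hAD : A = Matrix.of fun i j => ((Real.sqrt (x (r i)) : ℝ) : 𝕜) * (D * U) i j := by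
    ext i j
    rw [Matrix.of_apply, hA, Matrix.submatrix_apply, coordMatrix, Matrix.of_apply, inner_omega,
      id_eq, ← hud j, LinearEquiv.apply_symm_apply]
    congr 1
    exact (G.coboundaryMatrix_mul_apply 𝕜 U (r i) j).symm
  have hprod : ∏ e ∈ F, (x e : ℝ) = (∏ i, Real.sqrt (x (r i))) ^ 2 := by
    rw [← Finset.prod_pow, ← Finset.prod_coe_sort, ← Equiv.prod_comp r]
    exact Finset.prod_congr rfl fun i _ => (Real.sq_sqrt (x (r i)).2.le).symm
  have hdetA : A.det = ((∏ i, Real.sqrt (x (r i)) : ℝ) : 𝕜) * (D * U).det := by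
    rw [hAD, Matrix.det_mul_column, RCLike.ofReal_prod]
  have hK : ((projectionKernel x H).submatrix (Subtype.val : F → E) Subtype.val).det =
      (A * A.conjTranspose).det := by
    rw [projectionKernel_eq x h, ← Matrix.det_submatrix_equiv_self r, Matrix.submatrix_submatrix]
    rfl
  rw [hK, Matrix.det_mul, Matrix.det_conjTranspose, RCLike.star_def, RCLike.mul_conj, hdetA, hDU,
    norm_mul, norm_mul, RCLike.norm_ofReal, hprod, ← RCLike.ofReal_pow, mul_pow, sq_abs]
  congr 1
  ring

end OrientedGraph

/-! ### The determinantal measure -/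

open OrientedGraph in
theorem mainTheorem2 {𝕜 V E : Type*} [RCLike 𝕜] [Fintype V] [DecidableEq V]
    [Fintype E] [DecidableEq E] (G : OrientedGraph V E) (hG : G.Connected)
    (x : E → {r : ℝ // 0 < r}) (k : ℕ) (hk : 1 ≤ k)
    (Φ : Submodule 𝕜 (E → 𝕜)) (hΦ : Φ ⊓ G.cycles 𝕜 = ⊥)
    (φ : Module.Basis (Fin k) 𝕜 Φ) :
    -- the group of cuts of each contracted graph has an integral basis with `k` elements
    (∀ F : G.spanningForests (k + 1),
      Nonempty (Module.Basis (Fin k) ℤ (G.contractedCuts (F : Finset E)))) ∧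
    -- for any choice of these bases, and with the resulting weights `w`
    (∀ (κ : ∀ F : G.spanningForests (k + 1),
        Module.Basis (Fin k) ℤ (G.contractedCuts (F : Finset E)))
      (w : G.spanningForests (k + 1) → ℝ),
      (∀ F, w F = forestWeight x (exteriorPower.ιMulti 𝕜 k fun i => (φ i : E → 𝕜))
        (integralWedge 𝕜 (κ F)) F) →
      0 < ∑ F, w F ∧
      IsDeterminantal (fun F : G.spanningForests (k + 1) => (F : Finset E))
        (fun F => w F / ∑ F', w F')
        (OneForm.projectionKernel x
          (LinearMap.range (G.differential 𝕜 x) ⊓ (Φ.map (OneForm.J x))ᗮ))) ∧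
    -- the two descriptions of the subspace, the sum in the first one being direct
    Disjoint (LinearMap.ker (LinearMap.adjoint (G.differential 𝕜 x))) (Φ.map (OneForm.J x)) ∧
    (LinearMap.ker (LinearMap.adjoint (G.differential 𝕜 x)) ⊔ Φ.map (OneForm.J x))ᗮ =
      LinearMap.range (G.differential 𝕜 x) ⊓ (Φ.map (OneForm.J x))ᗮ := by
  refine ⟨fun F => hG.nonempty_basis_contractedCuts (G.mem_spanningForests.1 F.2).2,
    fun κ w hw => ?_, G.disjoint_ker_adjoint_differential x hΦ, ?_⟩
  swap
  · rw [← Submodule.inf_orthogonal, LinearMap.orthogonal_ker, LinearMap.adjoint_adjoint]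
  obtain ⟨v₀⟩ := id hG.1
  have hm := hG.finrank_range_differential_inf_orthogonal x hΦ φ
  generalize hH : LinearMap.range (G.differential 𝕜 x) ⊓ (Φ.map (OneForm.J x))ᗮ = H at hm ⊢
  set m := finrank 𝕜 H with hm'
  set h : OrthonormalBasis (Fin m) 𝕜 H := stdOrthonormalBasis 𝕜 H with hh
  have σ : Fin m ⊕ (Fin k ⊕ Unit) ≃ V := Fintype.equivOfCardEq (by simpa using hm)
  obtain ⟨c, hc⟩ := G.exists_projectionKernel_minor_eq x hΦ φ v₀ hH.symm h σ
  set K := OneForm.projectionKernel x H with hK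
  have hsum : ∀ S : Finset E, ∑ F ∈ Finset.univ.powersetCard m with S ⊆ F,
      (K.submatrix (Subtype.val : F → E) Subtype.val).det =
      (K.submatrix (Subtype.val : S → E) Subtype.val).det := fun S => by
    rw [hK, OneForm.projectionKernel_eq x h]
    exact Matrix.sum_minors_eq_of_mul_eq_one _ _
      (OneForm.conjTranspose_coordMatrix_mul_self x
        (h.orthonormal.comp_linearIsometry H.subtypeₗᵢ)) S
  have hcard : ∀ F ∈ G.spanningForests (k + 1), F.card = m := fun F hF => by
    obtain ⟨h1, h2⟩ := G.mem_spanningForests.1 hF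
    have := h1.card_add_card_components
    omega
  have hforest : ∀ F : G.spanningForests (k + 1),
      (K.submatrix (Subtype.val : F.1 → E) Subtype.val).det = ((c * w F : ℝ) : 𝕜) :=
    fun F => by
      have r : Fin m ≃ (F : Finset E) := Fintype.equivOfCardEq (by simp [hcard F.1 F.2])
      rw [hc F.1 r, hw F, forestWeight, integralWedge, wedgePairing_ιMulti, evalMatrix,
        (G.mem_spanningForests.1 F.2).1.norm_det_coboundaryMatrix hG r (κ F)]
  have hother : ∀ F : Finset E, F.card = m → F ∉ G.spanningForests (k + 1) →
      (K.submatrix (Subtype.val : F → E) Subtype.val).det = 0 := fun F hF hF' => by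
    have r : Fin m ≃ F := Fintype.equivOfCardEq (by simp [hF])
    -- An acyclic set of `m` edges would have exactly `k + 1` components.
    have hcyc : ¬ G.Acyclic F := fun hA => hF' (G.mem_spanningForests.2 ⟨hA, by
      have := hA.card_add_card_components
      omega⟩)
    rw [hc F r, G.det_coboundaryMatrix_eq_zero hcyc]
    simp
  have hmain : ∀ S : Finset E, ((∑ F : G.spanningForests (k + 1) with S ⊆ F.1, c * w F : ℝ) : 𝕜) =
      (K.submatrix (Subtype.val : S → E) Subtype.val).det := fun S => by
    rw [← hsum S, RCLike.ofReal_sum, Finset.sum_filter, Finset.sum_filter]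
    simp_rw [← hforest]
    rw [Finset.sum_coe_sort (G.spanningForests (k + 1)) fun F : Finset E =>
      if S ⊆ F then (K.submatrix (Subtype.val : F → E) Subtype.val).det else 0]
    refine Finset.sum_subset (fun F hF => ?_) fun F hF hF' => ?_
    · exact Finset.mem_powersetCard.2 ⟨Finset.subset_univ _, hcard F hF⟩
    · rw [hother F (Finset.mem_powersetCard.1 hF).2 hF', ite_self]
  -- The empty minor is `1`; this forces `∑ w ≠ 0` and identifies `c` as its inverse.
  have htotal : c * ∑ F, w F = 1 := by
    have h1 := hmain ∅
    rw [Matrix.det_isEmpty] at h1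
    simp only [Finset.empty_subset, Finset.filter_true, ← Finset.mul_sum] at h1
    exact_mod_cast h1
  have hpos : 0 < ∑ F, w F := by
    refine lt_of_le_of_ne (Finset.sum_nonneg fun F _ => ?_) fun h0 => ?_
    · rw [hw F]
      exact mul_nonneg (Finset.prod_nonneg fun e _ => (x e).2.le) (sq_nonneg _)
    · rw [← h0, mul_zero] at htotal
      exact zero_ne_one htotal
  refine ⟨hpos, fun S => Eq.trans ?_ (hmain S)⟩
  congr 1
  refine Finset.sum_congr rfl fun F _ => ?_
  rw [div_eq_iff hpos.ne', mul_right_comm, htotal, one_mul]
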